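/- Let $d\ge 0$ and let $X_{i,s}$, $1\le i\le d$, $s\ge 1$, be $d$ data streams with no change in mean (hypothesis $H_0$): $X_{i,s}=\mu_i+\varepsilon_{i,s}$ for all $s\ge 1$, with constants $\mu_i\in\mathbb{R}$ and random errors $\varepsilon_{i,s}$. Let $m$ be the length of the historical period, let $h=h(m)\in\mathbb{N}$ be a window size with $h\to\infty$ and $h/m\to\beta\in(0,1]$ as $m\to\infty$, and put $S_i(x)=\sum_{s=1}^{\lfloor x\rfloor}\varepsilon_{i,s}$. Let $W_1,\dots,W_d$ be independent standard Brownian motions on $[0,\infty)$ and assume the functional central limit theorem on the errors: there are constants $\sigma_i>0$ such that, as $m\to\infty$, the processes $u\mapsto m^{-1/2}S_i(mu)$, $1\le i\le d$, converge jointly in distribution to $\sigma_iW_i$, $1\le i\le d$, in $D[0,\infty)^d$, where $D[0,\infty)$ carries the Skorokhod topology. Let $\hat\sigma_i=\hat\sigma_i(m)$ be estimators with $\hat\sigma_i\to\sigma_i$ in probability as $m\to\infty$ for every $i$. Define the local MOSUM statistics and the weights $$\mathcal{T}_i(m,k,h)=\frac{1}{\hat\sigma_i}\left|\sum_{s=m+k-h+1}^{m+k}X_{i,s}-\frac{h}{m}\sum_{s=1}^{m}X_{i,s}\right|,\qquad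 w(k,h)=\frac{1}{\sqrt h}\,\rho\!\left(\frac kh\right),$$ with a function $\rho:\mathbb{R}\to\mathbb{R}$, and, for a local threshold $c_{\mathrm{Local}}\in\mathbb{R}$, the global MOSUM statistic $$\mathcal{T}(m,k,h)=\begin{cases}\sqrt{\sum_{i=1}^d\mathcal{T}_i(m,k,h)^2}&\text{in the centralized case,}\\[2pt] \sqrt{\sum_{i=1}^d\mathcal{T}_i(m,k,h)^2\,\mathbf 1\{w(k,h)\mathcal{T}_i(m,k,h)>c_{\mathrm{Local}}\}}&\text{in the distributed case.}\end{cases}$$ Let $t>0$, let $\rho$ be continuous at $t$, let $k=\lfloor ht\rfloor$, and put $$Z_i(t)=\left|W_i\!\left(\tfrac1\beta+t\right)-W_i\!\left(\tfrac1\beta+t-1\right)-\beta W_i\!\left(\tfrac1\beta\right)\right|.$$ Then, as $m\to\infty$, $w(k,h)\,\mathcal{T}(m,k,h)$ converges in distribution to $$\rho(t)\sqrt{\sum_{i=1}^dZ_i(t)^2}\ \text{ in the centralized case,}\qquad \rho(t)\sqrt{\sum_{i=1}^dZ_i(t)^2\,\mathbf 1\{\rho(t)Z_i(t)>c_{\mathrm{Local}}\}}\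 \text{ in the distributed case.}$$ -/

import Mathlib

open Filter Topology MeasureTheory ProbabilityTheory
open scoped NNReal

noncomputable section

namespace Mosum

/-! ### Weak convergence in the Skorokhod space `D[0, ∞)` -/

/-- A path on `[0, ∞)` that is right-continuous with left limits. -/
def IsCadlag (x : ℝ≥0 → ℝ) : Prop :=
  ∀ t, ContinuousWithinAt x (Set.Ici t) t ∧ ∃ l, Tendsto x (𝓝[<] t) (𝓝 l)

/-- The set of càdlàg paths on `[0, ∞)`. -/
def SkorokhodSpace : Type := {x : ℝ≥0 → ℝ // IsCadlag x}

/-- The σ-algebra generated by the evaluations; it is the Borel σ-algebra of the Skorokhod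
topology. -/
instance : MeasurableSpace SkorokhodSpace :=
  MeasurableSpace.comap (fun x : SkorokhodSpace => x.1) MeasurableSpace.pi

/-- Convergence of a sequence in the (metrizable) Skorokhod `J₁` topology of `D[0, ∞)`: there are
increasing bijections `lam n` of `[0, ∞)` with `lam n → id` uniformly and `x n ∘ lam n → y`
uniformly on bounded intervals. -/
def J1Tendsto (x : ℕ → SkorokhodSpace) (y : SkorokhodSpace) : Prop :=
  ∃ lam : ℕ → (ℝ≥0 ≃o ℝ≥0),
    TendstoUniformly (fun n s => lam n s) id atTop ∧
    ∀ T : ℝ≥0, TendstoUniformlyOn (fun n s => (x n).1 (lam n s)) y.1 atTop (Set.Iic T)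

/-- Continuity of a functional on a product of copies of `D[0, ∞)`; the `J₁` topology is
metrizable, so that sequential continuity is continuity. -/
def J1Continuous {ι : Type*} (F : (ι → SkorokhodSpace) → ℝ) : Prop :=
  ∀ (x : ℕ → ι → SkorokhodSpace) (y : ι → SkorokhodSpace),
    (∀ i, J1Tendsto (fun n => x n i) (y i)) → Tendsto (fun n => F (x n)) atTop (𝓝 (F y))

theorem isCadlag_of_continuous {x : ℝ≥0 → ℝ} (hx : Continuous x) : IsCadlag x :=
  fun t => ⟨hx.continuousWithinAt, x t, hx.continuousAt.tendsto.mono_left nhdsWithin_le_nhds⟩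

open scoped Classical in
/-- A path as an element of `D[0, ∞)`. It is used only for processes whose paths are almost surely
càdlàg; the value at other paths plays no role. -/
def toSkorokhod (x : ℝ≥0 → ℝ) : SkorokhodSpace :=
  if hx : IsCadlag x then ⟨x, hx⟩ else ⟨fun _ => 0, isCadlag_of_continuous continuous_const⟩

/-- Joint convergence in distribution, in a product of copies of `D[0, ∞)`, of the processes
`(X n i)_i` under `P` to the processes `(Y i)_i` under `P'`: the expectations of all bounded
continuous functionals converge. -/
def TendstoInDistributionD {ι Ω Ω' : Type*} [MeasurableSpace Ω] [MeasurableSpace Ω']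
    (X : ℕ → ι → ℝ≥0 → Ω → ℝ) (Y : ι → ℝ≥0 → Ω' → ℝ) (P : Measure Ω) (P' : Measure Ω') : Prop :=
  ∀ F : (ι → SkorokhodSpace) → ℝ, Measurable F → (∃ C, ∀ x, |F x| ≤ C) → J1Continuous F →
    Tendsto (fun n => ∫ ω, F (fun i => toSkorokhod (fun u => X n i u ω)) ∂P) atTop
      (𝓝 (∫ ω, F (fun i => toSkorokhod (fun u => Y i u ω)) ∂P'))

/-! ### Partial sums of the errors -/

/-- `S_i(x) = ∑_{1 ≤ s ≤ ⌊x⌋} ε_{i,s}`. -/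
def partialSum {ι Ω : Type*} (ε : ι → ℕ → Ω → ℝ) (i : ι) (x : ℝ) (ω : Ω) : ℝ :=
  ∑ s ∈ Finset.Icc 1 ⌊x⌋₊, ε i s ω

/-- The process `u ↦ S_i(m u) / √m`. -/
def scaledSum {ι Ω : Type*} (ε : ι → ℕ → Ω → ℝ) (m : ℕ) (i : ι) (u : ℝ≥0) (ω : Ω) : ℝ :=
  1 / √(m : ℝ) * partialSum ε i (m * u) ω

/-- The paths `u ↦ S_i(m u) / √m` are càdlàg. -/
theorem isCadlag_scaledSum {ι Ω : Type*} (ε : ι → ℕ → Ω → ℝ) (m : ℕ) (i : ι) (ω : Ω) :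
    IsCadlag (fun u => scaledSum ε m i u ω) := by
  set f : ℕ → ℝ := fun n => 1 / √(m : ℝ) * ∑ s ∈ Finset.Icc 1 n, ε i s ω with hf
  have key : (fun u => scaledSum ε m i u ω) = fun u : ℝ≥0 => f ⌊(m : ℝ≥0) * u⌋₊ := by
    funext u
    simp only [scaledSum, partialSum, hf]
    have : ⌊((m : ℝ) * (u : ℝ))⌋₊ = ⌊(m : ℝ≥0) * u⌋₊ := by
      apply le_antisymm
      · refine Nat.le_floor ?_
        have := Nat.floor_le (show (0 : ℝ) ≤ (m : ℝ) * (u : ℝ) by positivity)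
        exact_mod_cast this
      · refine Nat.le_floor ?_
        have := Nat.floor_le (show 0 ≤ (m : ℝ≥0) * u by positivity)
        exact_mod_cast this
    rw [this]
  rw [key]
  intro t
  have hmono : Monotone (fun u : ℝ≥0 => ⌊(m : ℝ≥0) * u⌋₊) :=
    fun a b hab => Nat.floor_mono (by gcongr)
  constructor
  · have hc : Continuous (fun u : ℝ≥0 => (m : ℝ≥0) * u) := by fun_prop
    have h1 : ∀ᶠ u in 𝓝[≥] t, (m : ℝ≥0) * u < (⌊(m : ℝ≥0) * t⌋₊ : ℝ≥0) + 1 :=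
      nhdsWithin_le_nhds
        (hc.continuousAt.eventually_lt continuousAt_const (Nat.lt_floor_add_one _))
    have h2 : (fun u : ℝ≥0 => f ⌊(m : ℝ≥0) * u⌋₊) =ᶠ[𝓝[≥] t]
        fun _ => f ⌊(m : ℝ≥0) * t⌋₊ := by
      filter_upwards [h1, self_mem_nhdsWithin] with u hu hut
      congr 1
      apply le_antisymm
      · have : ⌊(m : ℝ≥0) * u⌋₊ < ⌊(m : ℝ≥0) * t⌋₊ + 1 :=
          (Nat.floor_lt (by positivity)).2 (by push_cast; exact hu)
        omega
      · exact hmono hut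
    exact continuousWithinAt_const.congr_of_eventuallyEq h2 rfl
  · rcases eq_or_ne t 0 with rfl | ht
    · exact ⟨0, by simp⟩
    have hbdd : BddAbove ((fun u : ℝ≥0 => ⌊(m : ℝ≥0) * u⌋₊) '' Set.Iio t) :=
      ⟨⌊(m : ℝ≥0) * t⌋₊, by rintro _ ⟨u, hu, rfl⟩; exact hmono (le_of_lt hu)⟩
    have hne : (Set.Iio t).Nonempty := ⟨0, pos_iff_ne_zero.2 ht⟩
    have hlim : Tendsto (fun u : ℝ≥0 => ⌊(m : ℝ≥0) * u⌋₊) (𝓝[<] t)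
        (𝓝 (sSup ((fun u : ℝ≥0 => ⌊(m : ℝ≥0) * u⌋₊) '' Set.Iio t))) :=
      hmono.tendsto_nhdsLT t
    exact ⟨_, (continuous_of_discreteTopology (f := f)).continuousAt.tendsto.comp hlim⟩

/-- Functional central limit theorem for the errors: the processes `S_i(m ·) / √m`, `i : ι`,
converge jointly in distribution to `σ_i W_i(·)`, `i : ι`. -/
def FCLT {ι Ω Ω' : Type*} [MeasurableSpace Ω] [MeasurableSpace Ω']
    (ε : ι → ℕ → Ω → ℝ) (σ : ι → ℝ) (W : ι → ℝ≥0 → Ω' → ℝ)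
    (P : Measure Ω) (P' : Measure Ω') : Prop :=
  TendstoInDistributionD (scaledSum ε) (fun i u ω => σ i * W i u ω) P P'

/-! ### The asymptotic regime and the null hypothesis -/

/-- `h = h(m) → ∞` and `h / m → β ∈ (0, 1]` as `m → ∞`. -/
structure AsymptoticRegime (h : ℕ → ℕ) (β : ℝ) : Prop where
  window_tendsto : Tendsto h atTop atTop
  ratio_tendsto : Tendsto (fun m : ℕ => (h m : ℝ) / m) atTop (𝓝 β)
  pos : 0 < β
  le_one : β ≤ 1

/-- The null hypothesis (no change ever occurs): `X_{i,s} = μ_i + ε_{i,s}` for every `s ≥ 1`. -/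
def NullModel {ι Ω : Type*} (X : ι → ℕ → Ω → ℝ) (μ : ι → ℝ) (ε : ι → ℕ → Ω → ℝ) : Prop :=
  ∀ i s ω, 1 ≤ s → X i s ω = μ i + ε i s ω

/-! ### The MOSUM statistics -/

/-- The local MOSUM statistic `𝒯_i(m, k, h)` computed from the data `X` and the estimators `σhat` of
the long-run standard deviations. -/
def localStat {ι Ω : Type*} (X : ι → ℕ → Ω → ℝ) (σhat : ι → Ω → ℝ) (m k h : ℕ) (i : ι) (ω : Ω) :
    ℝ :=
  1 / σhat i ω *
    |∑ s ∈ Finset.Icc (m + k - h + 1) (m + k), X i s ω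
      - (h : ℝ) / m * ∑ s ∈ Finset.Icc 1 m, X i s ω|

/-- The weight `w(k, h) = h^{-1/2} ρ(k / h)`. -/
def weight (ρ : ℝ → ℝ) (k h : ℕ) : ℝ := 1 / √(h : ℝ) * ρ ((k : ℝ) / h)

/-- The global MOSUM statistic `𝒯(m, k, h)` in the centralized case. -/
def centralizedStat {ι Ω : Type*} [Fintype ι] (X : ι → ℕ → Ω → ℝ) (σhat : ι → Ω → ℝ)
    (m k h : ℕ) (ω : Ω) : ℝ :=
  √(∑ i, localStat X σhat m k h i ω ^ 2)

open scoped Classical in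
/-- The global MOSUM statistic `𝒯(m, k, h)` in the distributed case: only the sensors with
`w(k, h) 𝒯_i(m, k, h) > c` transmit. -/
def distributedStat {ι Ω : Type*} [Fintype ι] (ρ : ℝ → ℝ) (c : ℝ) (X : ι → ℕ → Ω → ℝ)
    (σhat : ι → Ω → ℝ) (m k h : ℕ) (ω : Ω) : ℝ :=
  √(∑ i, localStat X σhat m k h i ω ^ 2 *
    (if weight ρ k h * localStat X σhat m k h i ω > c then 1 else 0))

/-! ### The limits -/

/-- `Z_i(t) = |W_i(1/β + t) - W_i(1/β + t - 1) - β W_i(1/β)|`; all the times are non-negative for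
`0 < β ≤ 1` and `t > 0`. -/
def limitZ {ι Ω' : Type*} (W : ι → ℝ≥0 → Ω' → ℝ) (β t : ℝ) (i : ι) (ω : Ω') : ℝ :=
  |W i (1 / β + t).toNNReal ω - W i (1 / β + t - 1).toNNReal ω - β * W i (1 / β).toNNReal ω|

/-- The limit in the centralized case. -/
def centralizedLimit {ι Ω' : Type*} [Fintype ι] (ρ : ℝ → ℝ) (W : ι → ℝ≥0 → Ω' → ℝ) (β t : ℝ)
    (ω : Ω') : ℝ :=
  ρ t * √(∑ i, limitZ W β t i ω ^ 2)

open scoped Classical in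
/-- The limit in the distributed case. -/
def distributedLimit {ι Ω' : Type*} [Fintype ι] (ρ : ℝ → ℝ) (c : ℝ) (W : ι → ℝ≥0 → Ω' → ℝ)
    (β t : ℝ) (ω : Ω') : ℝ :=
  ρ t * √(∑ i, limitZ W β t i ω ^ 2 * (if ρ t * limitZ W β t i ω > c then 1 else 0))

end Mosum

end

/-!
Run the functional central limit theorem along the window length `h`. By the null hypothesis the
means cancel, and `h^{-1/2} 𝒯_i` becomes a contrast of the limiting process at the three times
`(m + k) / h`, `(m + k - h) / h` and `m / h`, which converge to `1/β + t`, `1/β + t - 1` and `1/β`.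

Evaluation at a time is not `J₁`-continuous, but the truncated distance between the graph of a path
and `{T} × S` is; for closed `S` and a continuous path it vanishes only if the value at `T` lies in
`S`. Through the portmanteau theorem this gives the convergence of the values at converging times.
The estimators and the weight enter by Slutsky's theorem and the continuous mapping theorem. In the
distributed case the map is discontinuous only where `ρ(t) Z_i(t) = c` for some `i`. If `ρ(t) ≠ 0`,
this is a null event, the contrast of a Brownian motion being a nondegenerate Gaussian variable; if
`ρ(t) = 0`, the indicators stay bounded while the weight tends to `0`.
-/

noncomputable section

namespace Mosum

section ConvergenceInDistribution

theorem map_le_map_of_ae_imp {Ω E F : Type*} [MeasurableSpace Ω] [MeasurableSpace E]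
    [MeasurableSpace F] {μ : Measure Ω} {f : Ω → E} {g : Ω → F} {A : Set E} {B : Set F}
    (hf : AEMeasurable f μ) (hg : AEMeasurable g μ) (hA : MeasurableSet A) (hB : MeasurableSet B)
    (h : ∀ᵐ ω ∂μ, f ω ∈ A → g ω ∈ B) : μ.map f A ≤ μ.map g B := by
  rw [Measure.map_apply_of_aemeasurable hf hA, Measure.map_apply_of_aemeasurable hg hB]
  exact measure_mono_ae h

theorem tendstoInMeasure_const_of_tendsto {Ω E ι : Type*} [MeasurableSpace Ω] {μ : Measure Ω}
    [PseudoEMetricSpace E] {l : Filter ι} {u : ι → E} {c : E} (hu : Tendsto u l (𝓝 c)) :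
    TendstoInMeasure μ (fun n _ => u n) l fun _ => c := by
  intro r hr
  refine tendsto_const_nhds.congr' ?_
  filter_upwards [EMetric.tendsto_nhds.1 hu r hr] with n hn
  simp [not_le.2 hn]

theorem tendstoInMeasure_pi {Ω κ ι : Type*} {E : κ → Type*} [Fintype κ]
    [∀ j, PseudoEMetricSpace (E j)] [MeasurableSpace Ω] {μ : Measure Ω} {l : Filter ι}
    {f : ι → ∀ j, Ω → E j} {g : ∀ j, Ω → E j}
    (h : ∀ j, TendstoInMeasure μ (fun n => f n j) l (g j)) :
    TendstoInMeasure μ (fun n ω j => f n j ω) l (fun ω j => g j ω) := by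
  intro r hr
  have hsum : Tendsto (fun n => ∑ j, μ {ω | r ≤ edist (f n j ω) (g j ω)}) l (𝓝 0) := by
    simpa using tendsto_finsetSum Finset.univ fun j _ => h j r hr
  refine tendsto_of_tendsto_of_tendsto_of_le_of_le tendsto_const_nhds hsum (fun _ => zero_le)
    fun n => (measure_mono fun ω hω => ?_).trans (measure_iUnion_fintype_le μ _)
  contrapose! hω
  simp only [Set.mem_iUnion, Set.mem_ofPred_eq, not_exists, not_le] at hω ⊢
  rw [edist_pi_def]
  exact (Finset.sup_lt_iff hr).2 fun j _ => hω j

variable {ι E F Ω' : Type*} {Ω : ι → Type*} {m : ∀ i, MeasurableSpace (Ω i)}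
  {μ : (i : ι) → Measure (Ω i)} [∀ i, IsProbabilityMeasure (μ i)] {m' : MeasurableSpace Ω'}
  {μ' : Measure Ω'} [IsProbabilityMeasure μ'] [TopologicalSpace E] {mE : MeasurableSpace E}
  [OpensMeasurableSpace E] {X Y : (i : ι) → Ω i → E} {Z : Ω' → E} {l : Filter ι}

theorem tendstoInDistribution_comp_of_ae_continuousAt [HasOuterApproxClosed E]
    [l.IsCountablyGenerated] [TopologicalSpace F] [MeasurableSpace F] [OpensMeasurableSpace F]
    {g : E → F} (hg : Measurable g) (h : TendstoInDistribution X l Z μ μ')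
    (hgc : ∀ᵐ ω ∂μ', ContinuousAt g (Z ω)) :
    TendstoInDistribution (fun n ω => g (X n ω)) l (fun ω => g (Z ω)) μ μ' where
  forall_aemeasurable n := hg.comp_aemeasurable (h.forall_aemeasurable n)
  aemeasurable_limit := hg.comp_aemeasurable h.aemeasurable_limit
  tendsto := by
    have hgX : ∀ n, AEMeasurable (fun ω => g (X n ω)) (μ n) := fun n =>
      hg.comp_aemeasurable (h.forall_aemeasurable n)
    have hgZ : AEMeasurable (fun ω => g (Z ω)) μ' := hg.comp_aemeasurable h.aemeasurable_limit
    refine tendsto_of_forall_isClosed_limsup_le' fun S hS => ?_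
    simp only [ProbabilityMeasure.coe_mk]
    have hcl : IsClosed (closure (g ⁻¹' S)) := isClosed_closure
    have hclosure : ∀ ω, ContinuousAt g (Z ω) → Z ω ∈ closure (g ⁻¹' S) → g (Z ω) ∈ S :=
      fun ω hω hmem => hS.closure_subset_iff.2 (Set.image_preimage_subset g S)
        (hω.continuousWithinAt.mem_closure_image hmem)
    calc l.limsup (fun n => (μ n).map (fun ω => g (X n ω)) S)
        ≤ l.limsup (fun n => (μ n).map (X n) (closure (g ⁻¹' S))) :=
          limsup_le_limsup <| Eventually.of_forall fun n =>
            map_le_map_of_ae_imp (hgX n) (h.forall_aemeasurable n) hS.measurableSet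
              hcl.measurableSet <| ae_of_all _ fun ω hω => subset_closure hω
      _ ≤ μ'.map Z (closure (g ⁻¹' S)) :=
          ProbabilityMeasure.limsup_measure_closed_le_of_tendsto h.tendsto hcl
      _ ≤ μ'.map (fun ω => g (Z ω)) S :=
          map_le_map_of_ae_imp h.aemeasurable_limit hgZ hcl.measurableSet hS.measurableSet <|
            hgc.mono hclosure

theorem tendstoInDistribution_congr_of_eventually (h : TendstoInDistribution X l Z μ μ')
    (hY : ∀ n, AEMeasurable (Y n) (μ n)) (hXY : ∀ᶠ n in l, X n = Y n) :
    TendstoInDistribution Y l Z μ μ' where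
  forall_aemeasurable := hY
  aemeasurable_limit := h.aemeasurable_limit
  tendsto := h.tendsto.congr' (hXY.mono fun n hn => Subtype.ext (by simp only [hn]))

end ConvergenceInDistribution

section Evaluation

variable {ι κ : Type*}

theorem abs_ciInf_sub_ciInf_le {α : Type*} [Nonempty α] {f g : α → ℝ} {r : ℝ}
    (hf : BddBelow (Set.range f)) (hg : BddBelow (Set.range g)) (h : ∀ a, |f a - g a| ≤ r) :
    |(⨅ a, f a) - ⨅ a, g a| ≤ r := by
  have hfg : (⨅ a, f a) - r ≤ ⨅ a, g a :=
    le_ciInf fun a => by linarith [ciInf_le hf a, (abs_le.1 (h a)).2]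
  have hgf : (⨅ a, g a) - r ≤ ⨅ a, f a :=
    le_ciInf fun a => by linarith [ciInf_le hg a, (abs_le.1 (h a)).1]
  exact abs_le.2 ⟨by linarith, by linarith⟩

theorem ciInf_eq_ciInf_denseSeq {f : (κ → ℝ≥0) → ℝ} [Finite κ] (hbdd : BddBelow (Set.range f))
    (hf : ∀ τ, ContinuousWithinAt f (Set.Ici τ) τ) :
    ⨅ τ, f τ = ⨅ n, f (TopologicalSpace.denseSeq (κ → ℝ≥0) n) := by
  set u := TopologicalSpace.denseSeq (κ → ℝ≥0)
  have hbdd' : BddBelow (Set.range fun n => f (u n)) := hbdd.mono (Set.range_comp_subset_range u f)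
  refine le_antisymm (le_ciInf fun n => ciInf_le hbdd _) (le_ciInf fun τ => ?_)
  let U : Set (κ → ℝ≥0) := Set.univ.pi fun p => Set.Ioi (τ p)
  have hU : IsOpen U := isOpen_set_pi Set.finite_univ fun p _ => isOpen_Ioi
  have hτ : τ ∈ closure (U ∩ Set.range u) := by
    refine closure_minimal ((TopologicalSpace.denseRange_denseSeq _).open_subset_closure_inter hU)
      isClosed_closure ?_
    rw [closure_pi_set]
    exact fun p _ => by simp
  have hUτ : U ∩ Set.range u ⊆ Set.Ici τ := fun s hs p => (hs.1 p trivial).le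
  have : (𝓝[U ∩ Set.range u] τ).NeBot := mem_closure_iff_nhdsWithin_neBot.1 hτ
  refine ge_of_tendsto ((hf τ).mono hUτ) ?_
  filter_upwards [self_mem_nhdsWithin] with s hs
  obtain ⟨n, rfl⟩ := hs.2
  exact ciInf_le hbdd' n

variable [Fintype κ]

/-- The distance of the set of points `(τ, (x_{a p}(τ_p))_p)` to `{T} × S`, truncated at `1`. It is
used to test the event `(x_{a p}(T_p))_p ∈ S`, since it depends `J₁`-continuously on `x`, which the
values `x_{a p}(T_p)` do not. -/
def graphInfDist (a : κ → ι) (T : κ → ℝ≥0) (S : Set (κ → ℝ)) (x : ι → ℝ≥0 → ℝ) : ℝ :=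
  ⨅ τ : κ → ℝ≥0, min 1 (dist τ T + Metric.infDist (fun p => x (a p) (τ p)) S)

variable {a : κ → ι} {T : κ → ℝ≥0} {S : Set (κ → ℝ)} {x : ι → ℝ≥0 → ℝ}

theorem bddBelow_range_graphInfDist :
    BddBelow (Set.range fun τ : κ → ℝ≥0 =>
      min 1 (dist τ T + Metric.infDist (fun p => x (a p) (τ p)) S)) := by
  refine ⟨0, ?_⟩
  rintro _ ⟨τ, rfl⟩
  exact le_min zero_le_one (add_nonneg dist_nonneg Metric.infDist_nonneg)

theorem graphInfDist_le_dist {τ : κ → ℝ≥0} (hτ : (fun p => x (a p) (τ p)) ∈ S) :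
    graphInfDist a T S x ≤ dist τ T :=
  (ciInf_le bddBelow_range_graphInfDist τ).trans <| (min_le_right _ _).trans <| by
    rw [Metric.infDist_zero_of_mem hτ, add_zero]

theorem mem_of_graphInfDist_nonpos (hS : IsClosed S) (hne : S.Nonempty)
    (hx : ∀ i, Continuous (x i)) (h : graphInfDist a T S x ≤ 0) :
    (fun p => x (a p) (T p)) ∈ S := by
  by_contra hT
  have hcont : Continuous fun τ : κ → ℝ≥0 => Metric.infDist (fun p => x (a p) (τ p)) S :=
    (Metric.continuous_infDist_pt S).comp
      (continuous_pi fun p => (hx (a p)).comp (continuous_apply p))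
  have hpos : 0 < Metric.infDist (fun p => x (a p) (T p)) S :=
    (hS.notMem_iff_infDist_pos hne).1 hT
  obtain ⟨r, hr, hrS⟩ := exists_between hpos
  obtain ⟨δ, hδ, hball⟩ := Metric.eventually_nhds_iff.1 (hcont.continuousAt.eventually_const_lt hrS)
  have hle : min 1 (min δ r) ≤ graphInfDist a T S x := by
    refine le_ciInf fun τ => min_le_min_left 1 ?_
    rcases lt_or_ge (dist τ T) δ with hτ | hτ
    · exact (min_le_right _ _).trans ((hball hτ).le.trans (le_add_of_nonneg_left dist_nonneg))
    · exact (min_le_left _ _).trans (hτ.trans (le_add_of_nonneg_right Metric.infDist_nonneg))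
  exact (hle.trans h).not_gt (lt_min one_pos (lt_min hδ hr))

theorem graphInfDist_eq_ciInf_denseSeq (hx : ∀ i, IsCadlag (x i)) :
    graphInfDist a T S x = ⨅ n, min 1
      (dist (TopologicalSpace.denseSeq (κ → ℝ≥0) n) T +
        Metric.infDist (fun p => x (a p) (TopologicalSpace.denseSeq (κ → ℝ≥0) n p)) S) := by
  refine ciInf_eq_ciInf_denseSeq bddBelow_range_graphInfDist fun τ => ?_
  have hxτ : ContinuousWithinAt (fun τ : κ → ℝ≥0 => fun p => x (a p) (τ p)) (Set.Ici τ) τ :=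
    continuousWithinAt_pi.2 fun p =>
      (hx (a p) (τ p)).1.comp (f := fun τ : κ → ℝ≥0 => τ p)
        (continuous_apply p).continuousWithinAt fun s hs => hs p
  have hS := (Metric.continuous_infDist_pt S).continuousAt.comp_continuousWithinAt hxτ
  have hT : ContinuousWithinAt (fun τ : κ → ℝ≥0 => dist τ T) (Set.Ici τ) τ :=
    (continuous_id.dist continuous_const).continuousWithinAt
  exact continuousWithinAt_const.min (hT.add hS)

theorem aemeasurable_graphInfDist {Ω : Type*} [MeasurableSpace Ω] {P : Measure Ω}
    {X : ι → ℝ≥0 → Ω → ℝ} (hX : ∀ i s, AEMeasurable (X i s) P)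
    (hX_cadlag : ∀ᵐ ω ∂P, ∀ i, IsCadlag fun s => X i s ω) :
    AEMeasurable (fun ω => graphInfDist a T S fun i s => X i s ω) P := by
  refine AEMeasurable.congr (AEMeasurable.iInf fun n => ?_) <| hX_cadlag.mono fun ω hω =>
    (graphInfDist_eq_ciInf_denseSeq hω).symm
  refine aemeasurable_const.min (aemeasurable_const.add ?_)
  exact (Metric.continuous_infDist_pt S).measurable.comp_aemeasurable
    (aemeasurable_pi_lambda _ fun p => hX (a p) _)

theorem measurable_eval_skorokhodSpace (s : ℝ≥0) : Measurable fun x : SkorokhodSpace => x.1 s :=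
  (measurable_pi_apply s).comp (comap_measurable _)

theorem measurable_graphInfDist :
    Measurable fun x : ι → SkorokhodSpace => graphInfDist a T S fun i => (x i).1 := by
  simp_rw [fun x : ι → SkorokhodSpace =>
    graphInfDist_eq_ciInf_denseSeq (a := a) (T := T) (S := S) fun i => (x i).2]
  refine Measurable.iInf fun n => measurable_const.min (measurable_const.add ?_)
  exact (Metric.continuous_infDist_pt S).measurable.comp (measurable_pi_lambda _ fun p =>
    (measurable_eval_skorokhodSpace _).comp (measurable_pi_apply (a p)))

theorem abs_graphInfDist_sub_le {y : ι → ℝ≥0 → ℝ} {η : ℝ} (lam : ι → ℝ≥0 ≃ ℝ≥0)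
    (hη0 : 0 ≤ η) (hη : η ≤ 1)
    (hlam : ∀ p s, dist (lam (a p) s) s ≤ η)
    (hxy : ∀ p, ∀ s ≤ T p + 2, dist (x (a p) (lam (a p) s)) (y (a p) s) ≤ η) :
    |graphInfDist a T S x - graphInfDist a T S y| ≤ 2 * η := by
  have hreparam : graphInfDist a T S x = ⨅ τ : κ → ℝ≥0, min 1
      (dist (fun p => lam (a p) (τ p)) T +
        Metric.infDist (fun p => x (a p) (lam (a p) (τ p))) S) :=
    ((Equiv.piCongrRight fun p => lam (a p)).iInf_comp (g := fun τ => min 1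
      (dist τ T + Metric.infDist (fun p => x (a p) (τ p)) S))).symm
  rw [hreparam]
  refine abs_ciInf_sub_ciInf_le ⟨0, ?_⟩ bddBelow_range_graphInfDist fun τ => ?_
  · rintro _ ⟨τ, rfl⟩
    exact le_min zero_le_one (add_nonneg dist_nonneg Metric.infDist_nonneg)
  have hdist : dist (fun p => lam (a p) (τ p)) τ ≤ η :=
    (dist_pi_le_iff hη0).2 fun p => hlam p _
  -- Where `dist τ T > 2`, both terms are truncated to `1`.
  rcases le_or_gt (dist τ T) 2 with hτ | hτ
  · have hle : ∀ p, τ p ≤ T p + 2 := fun p => by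
      have hp := (dist_le_pi_dist τ T p).trans hτ
      rw [NNReal.dist_eq] at hp
      rw [← NNReal.coe_le_coe, NNReal.coe_add, NNReal.coe_ofNat]
      linarith [(abs_le.1 hp).2]
    have hinf : |Metric.infDist (fun p => x (a p) (lam (a p) (τ p))) S -
        Metric.infDist (fun p => y (a p) (τ p)) S| ≤ η :=
      (Metric.lipschitz_infDist_pt S |>.dist_le_mul _ _).trans <| by
        rw [NNReal.coe_one, one_mul]
        exact (dist_pi_le_iff hη0).2 fun p => hxy p _ (hle p)
    refine (abs_min_sub_min_le_max 1 _ 1 _).trans (max_le (by simpa using hη0) ?_)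
    rw [add_sub_add_comm, two_mul]
    exact (abs_add_le _ _).trans (add_le_add ((abs_dist_sub_le _ _ _).trans hdist) hinf)
  · have htri := dist_triangle_left τ T fun p => lam (a p) (τ p)
    rw [min_eq_left, min_eq_left, sub_self, abs_zero]
    · positivity
    · linarith [Metric.infDist_nonneg (x := fun p => y (a p) (τ p)) (s := S)]
    · linarith [Metric.infDist_nonneg (x := fun p => x (a p) (lam (a p) (τ p))) (s := S)]

theorem j1Continuous_graphInfDist :
    J1Continuous fun x : ι → SkorokhodSpace => graphInfDist a T S fun i => (x i).1 := by
  intro x y hxy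
  choose lam hlam hunif using hxy
  refine Metric.tendsto_nhds.2 fun r hr => ?_
  set η := min 1 (r / 3)
  have hη : 0 < η := lt_min one_pos (by positivity)
  have hlam' : ∀ᶠ n in atTop, ∀ p s, dist (lam (a p) n s) s < η :=
    eventually_all.2 fun p => by
      simpa only [id, dist_comm] using Metric.tendstoUniformly_iff.1 (hlam (a p)) η hη
  have hunif' : ∀ᶠ n in atTop, ∀ p, ∀ s ≤ T p + 2,
      dist ((x n (a p)).1 (lam (a p) n s)) ((y (a p)).1 s) < η :=
    eventually_all.2 fun p => by
      simpa only [Set.mem_Iic, dist_comm] using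
        Metric.tendstoUniformlyOn_iff.1 (hunif (a p) (T p + 2)) η hη
  filter_upwards [hlam', hunif'] with n hn hn'
  calc |graphInfDist a T S (fun i => (x n i).1) - graphInfDist a T S fun i => (y i).1|
      ≤ 2 * η := abs_graphInfDist_sub_le (fun i => (lam i n).toEquiv) hη.le (min_le_left _ _)
        (fun p s => (hn p s).le) fun p s hs => (hn' p s hs).le
    _ < r := by linarith [min_le_right 1 (r / 3)]

theorem coe_toSkorokhod {x : ℝ≥0 → ℝ} (hx : IsCadlag x) : (toSkorokhod x).1 = x :=
  congrArg Subtype.val (dif_pos hx : toSkorokhod x = ⟨x, hx⟩)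

variable {ι Ω Ω' : Type*} [MeasurableSpace Ω] [MeasurableSpace Ω']
  {P : Measure Ω} {P' : Measure Ω'} {X : ℕ → ι → ℝ≥0 → Ω → ℝ} {Y : ι → ℝ≥0 → Ω' → ℝ}

theorem TendstoInDistributionD.comp_tendsto {u : ℕ → ℕ} (hXY : TendstoInDistributionD X Y P P')
    (hu : Tendsto u atTop atTop) : TendstoInDistributionD (fun n => X (u n)) Y P P' :=
  fun F hF hFb hFc => (hXY F hF hFb hFc).comp hu

variable [IsProbabilityMeasure P] [IsProbabilityMeasure P']

theorem TendstoInDistributionD.tendstoInDistribution_of_j1Continuous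
    {F : (ι → SkorokhodSpace) → ℝ} (hXY : TendstoInDistributionD X Y P P') (hF : Measurable F)
    (hFc : J1Continuous F)
    (hFX : ∀ n, AEMeasurable (fun ω => F fun i => toSkorokhod fun u => X n i u ω) P)
    (hFY : AEMeasurable (fun ω => F fun i => toSkorokhod fun u => Y i u ω) P') :
    TendstoInDistribution (fun n ω => F fun i => toSkorokhod fun u => X n i u ω) atTop
      (fun ω => F fun i => toSkorokhod fun u => Y i u ω) (fun _ => P) P' where
  forall_aemeasurable := hFX
  aemeasurable_limit := hFY
  tendsto := by
    refine ProbabilityMeasure.tendsto_iff_forall_integral_tendsto.2 fun φ => ?_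
    simp only [ProbabilityMeasure.coe_mk]
    rw [integral_map hFY φ.continuous.aestronglyMeasurable]
    simp_rw [fun n => integral_map (hFX n) φ.continuous.aestronglyMeasurable]
    exact hXY (fun x => φ (F x)) (φ.continuous.measurable.comp hF)
      ⟨‖φ‖, fun x => φ.norm_coe_le_norm (F x)⟩ fun x y hxy =>
        (φ.continuous.tendsto (F y)).comp (hFc x y hxy)

variable {κ : Type*} {a : κ → ι} {T : κ → ℝ≥0}

theorem TendstoInDistributionD.tendstoInDistribution_graphInfDist [Fintype κ] (S : Set (κ → ℝ))
    (hXY : TendstoInDistributionD X Y P P')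
    (hX : ∀ n i u, AEMeasurable (X n i u) P)
    (hX_cadlag : ∀ n, ∀ᵐ ω ∂P, ∀ i, IsCadlag fun u => X n i u ω)
    (hY : ∀ i u, AEMeasurable (Y i u) P') (hY_cadlag : ∀ᵐ ω ∂P', ∀ i, IsCadlag fun u => Y i u ω) :
    TendstoInDistribution (fun n ω => graphInfDist a T S fun i u => X n i u ω) atTop
      (fun ω => graphInfDist a T S fun i u => Y i u ω) (fun _ => P) P' := by
  have hGX : ∀ n, (fun ω => graphInfDist a T S fun i => (toSkorokhod fun u => X n i u ω).1)
      =ᵐ[P] fun ω => graphInfDist a T S fun i u => X n i u ω := fun n => by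
    filter_upwards [hX_cadlag n] with ω hω
    simp only [coe_toSkorokhod (hω _)]
  have hGY : (fun ω => graphInfDist a T S fun i => (toSkorokhod fun u => Y i u ω).1)
      =ᵐ[P'] fun ω => graphInfDist a T S fun i u => Y i u ω := by
    filter_upwards [hY_cadlag] with ω hω
    simp only [coe_toSkorokhod (hω _)]
  exact (hXY.tendstoInDistribution_of_j1Continuous measurable_graphInfDist j1Continuous_graphInfDist
    (fun n => (aemeasurable_graphInfDist (hX n) (hX_cadlag n)).congr (hGX n).symm)
    ((aemeasurable_graphInfDist hY hY_cadlag).congr hGY.symm)).congr hGX hGY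

theorem TendstoInDistributionD.tendstoInDistribution_eval [Finite κ]
    (hXY : TendstoInDistributionD X Y P P')
    (hX : ∀ n i u, AEMeasurable (X n i u) P)
    (hX_cadlag : ∀ n, ∀ᵐ ω ∂P, ∀ i, IsCadlag fun u => X n i u ω)
    (hY : ∀ i u, AEMeasurable (Y i u) P')
    (hY_cont : ∀ᵐ ω ∂P', ∀ i, Continuous fun u => Y i u ω)
    (a : κ → ι) {τ : ℕ → κ → ℝ≥0} (hτ : Tendsto τ atTop (𝓝 T)) :
    TendstoInDistribution (fun n ω p => X n (a p) (τ n p) ω) atTop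
      (fun ω p => Y (a p) (T p) ω) (fun _ => P) P' := by
  have := Fintype.ofFinite κ
  have hXτ : ∀ n, AEMeasurable (fun ω p => X n (a p) (τ n p) ω) P := fun n =>
    aemeasurable_pi_lambda _ fun p => hX n (a p) (τ n p)
  have hYT : AEMeasurable (fun ω p => Y (a p) (T p) ω) P' :=
    aemeasurable_pi_lambda _ fun p => hY (a p) (T p)
  refine ⟨hXτ, hYT, tendsto_of_forall_isClosed_limsup_le' fun S hS => ?_⟩
  simp only [ProbabilityMeasure.coe_mk]
  rcases S.eq_empty_or_nonempty with rfl | hne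
  · simp
  have hdist : Tendsto (fun n => -dist (τ n) T) atTop (𝓝 0) := by
    simpa using (tendsto_iff_dist_tendsto_zero.1 hτ).neg
  have hG : TendstoInDistribution
      (fun n ω => graphInfDist a T S (fun i u => X n i u ω) + -dist (τ n) T) atTop
      (fun ω => graphInfDist a T S (fun i u => Y i u ω) + 0) (fun _ => P) P' :=
    (hXY.tendstoInDistribution_graphInfDist S hX hX_cadlag hY
      (hY_cont.mono fun ω hω i => isCadlag_of_continuous (hω i))).add_of_tendstoInMeasure_const
        (tendstoInMeasure_const_of_tendsto hdist) fun n => aemeasurable_const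
  calc atTop.limsup (fun n => P.map (fun ω p => X n (a p) (τ n p) ω) S)
      ≤ atTop.limsup (fun n => P.map
          (fun ω => graphInfDist a T S (fun i u => X n i u ω) + -dist (τ n) T) (Set.Iic 0)) :=
        limsup_le_limsup <| Eventually.of_forall fun n =>
          map_le_map_of_ae_imp (hXτ n) (hG.forall_aemeasurable n) hS.measurableSet
            measurableSet_Iic <| ae_of_all _ fun ω hω => by simpa using graphInfDist_le_dist hω
    _ ≤ P'.map (fun ω => graphInfDist a T S (fun i u => Y i u ω) + 0) (Set.Iic 0) :=
        ProbabilityMeasure.limsup_measure_closed_le_of_tendsto hG.tendsto isClosed_Iic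
    _ ≤ P'.map (fun ω p => Y (a p) (T p) ω) S :=
        map_le_map_of_ae_imp hG.aemeasurable_limit hYT measurableSet_Iic hS.measurableSet <|
          hY_cont.mono fun ω hω hmem => mem_of_graphInfDist_nonpos hS hne hω (by simpa using hmem)

end Evaluation

section Contrast

/-- The linear contrast `v₀ - v₁ - b v₂`; the MOSUM statistics and their limits are built from its
values at the partial sums, respectively at a Brownian path, at three times. -/
def contrast (b : ℝ) (v : Fin 3 → ℝ) : ℝ := v 0 - v 1 - b * v 2

theorem contrast_const_mul (b r : ℝ) (v : Fin 3 → ℝ) :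
    contrast b (fun j => r * v j) = r * contrast b v := by
  unfold contrast
  ring

/-- The times `1/β + t`, `1/β + t - 1` and `1/β` of the limiting contrast. -/
def contrastTimes (β t : ℝ) : Fin 3 → ℝ≥0 :=
  ![(1 / β + t).toNNReal, (1 / β + t - 1).toNNReal, (1 / β).toNNReal]

theorem limitZ_eq_abs_contrast {ι Ω' : Type*} (W : ι → ℝ≥0 → Ω' → ℝ) (β t : ℝ) (i : ι) (ω : Ω') :
    limitZ W β t i ω = |contrast β fun j => W i (contrastTimes β t j) ω| := rfl

variable {Ω : Type*} [MeasurableSpace Ω] {P : Measure Ω} {B : ℝ≥0 → Ω → ℝ}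

theorem hasGaussianLaw_contrast (hB : IsGaussianProcess B P) (b : ℝ) (u : Fin 3 → ℝ≥0) :
    HasGaussianLaw (fun ω => contrast b fun j => B (u j) ω) P := by
  have hsum := ((hB.comp_right u).smul ![1, -1, -b]).hasGaussianLaw_fun_sum (I := Finset.univ)
  simp only [Fin.sum_univ_three, Matrix.cons_val_zero, Matrix.cons_val_one, Matrix.cons_val,
    Function.comp_apply, smul_eq_mul, one_mul, neg_mul, ← sub_eq_add_neg] at hsum
  exact hsum

theorem variance_contrast (hB : IsPreBrownianReal B P) (b : ℝ) (u : Fin 3 → ℝ≥0) :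
    Var[fun ω => contrast b fun j => B (u j) ω; P] =
      u 0 + u 1 + b ^ 2 * u 2 - 2 * min (u 0) (u 1) - 2 * b * min (u 0) (u 2)
        + 2 * b * min (u 1) (u 2) := by
  have := hB.isGaussianProcess.isProbabilityMeasure
  have hL : ∀ j, MemLp (fun ω => B (u j) ω) 2 P := fun j =>
    (hB.isGaussianProcess.hasGaussianLaw_eval (u j)).memLp_two
  have hd : MemLp (fun ω => B (u 0) ω - B (u 1) ω) 2 P := (hL 0).sub (hL 1)
  simp only [contrast]
  rw [variance_fun_sub hd ((hL 2).const_mul b), variance_fun_sub (hL 0) (hL 1),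
    variance_const_mul, covariance_const_mul_right, covariance_fun_sub_left (hL 0) (hL 1) (hL 2)]
  simp only [← covariance_self (hL _).aemeasurable, hB.covariance_fun_eval, min_self]
  push_cast
  ring

theorem variance_contrast_contrastTimes_pos (hB : IsPreBrownianReal B P) {β t : ℝ} (hβ : 0 < β)
    (ht : 0 ≤ t) (hβt : 1 < 1 / β + t) :
    0 < Var[fun ω => contrast β fun j => B (contrastTimes β t j) ω; P] := by
  have hβ' : 0 < 1 / β := one_div_pos.2 hβ
  have hββ : β * (1 / β) = 1 := mul_one_div_cancel hβ.ne'
  rw [variance_contrast hB]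
  simp only [contrastTimes, Matrix.cons_val_zero, Matrix.cons_val_one, Matrix.cons_val,
    NNReal.coe_min]
  rw [Real.coe_toNNReal _ (by linarith), Real.coe_toNNReal _ (by linarith),
    Real.coe_toNNReal _ hβ'.le, min_eq_right (by linarith), min_eq_right (by linarith)]
  rcases le_total (1 / β + t - 1) (1 / β) with h | h
  · rw [min_eq_left h]
    calc 0 < β * (1 / β + t - 1) + β * t :=
          add_pos_of_pos_of_nonneg (mul_pos hβ (by linarith)) (mul_nonneg hβ.le ht)
      _ = _ := by linear_combination (1 - β) * hββ
  · rw [min_eq_right h]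
    calc 0 < 1 + β := by positivity
      _ = _ := by linear_combination -β * hββ

theorem ae_ne_of_hasGaussianLaw {Z : Ω → ℝ} (hZ : HasGaussianLaw Z P) (hvar : 0 < Var[Z; P])
    (z : ℝ) : ∀ᵐ ω ∂P, Z ω ≠ z := by
  have := nullSingletonClass_gaussianReal (μ := P[Z]) (Real.toNNReal_pos.2 hvar).ne'
  rw [← hZ.map_eq_gaussianReal] at this
  exact ae_of_ae_map hZ.aemeasurable (compl_mem_ae_iff.2 (measure_singleton z))

theorem ae_limitZ_ne {ι : Type*} {W : ι → ℝ≥0 → Ω → ℝ} {i : ι} (hW : IsPreBrownianReal (W i) P)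
    {β t : ℝ} (hβ : 0 < β) (ht : 0 ≤ t) (hβt : 1 < 1 / β + t) (z : ℝ) :
    ∀ᵐ ω ∂P, limitZ W β t i ω ≠ z := by
  have hne := ae_ne_of_hasGaussianLaw
    (hasGaussianLaw_contrast hW.isGaussianProcess β (contrastTimes β t))
    (variance_contrast_contrastTimes_pos hW hβ ht hβt)
  filter_upwards [hne z, hne (-z)] with ω hω hω'
  rw [limitZ_eq_abs_contrast]
  intro h
  rcases eq_or_eq_neg_of_abs_eq h with h | h
  exacts [hω h, hω' h]

end Contrast

section Local

variable {ι Ω : Type*} {X ε : ι → ℕ → Ω → ℝ} {μ : ι → ℝ} {σhat : ι → Ω → ℝ}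

/-- The indices `m + k`, `m + k - h` and `m` of the partial sums entering `𝒯_i(m, k, h)`; the
subtraction is truncated. -/
def sampleIndices (m k h : ℕ) : Fin 3 → ℕ := ![m + k, m + k - h, m]

/-- The local statistics `h^{-1/2} 𝒯_i(m, k, h)`, on the scale on which they converge. -/
def scaledLocalStat (X : ι → ℕ → Ω → ℝ) (σhat : ι → Ω → ℝ) (m k h : ℕ) (ω : Ω) (i : ι) : ℝ :=
  1 / √(h : ℝ) * localStat X σhat m k h i ω

theorem sum_Icc_succ_eq_sub (f : ℕ → ℝ) {a b : ℕ} (hab : a ≤ b) :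
    ∑ s ∈ Finset.Icc (a + 1) b, f s = ∑ s ∈ Finset.Icc 1 b, f s - ∑ s ∈ Finset.Icc 1 a, f s := by
  rw [eq_sub_iff_add_eq', Finset.Icc_add_one_left_eq_Ioc]
  exact Finset.sum_Ioc_consecutive f (Nat.zero_le a) hab

theorem NullModel.sum_Icc_one (hX : NullModel X μ ε) (i : ι) (n : ℕ) (ω : Ω) :
    ∑ s ∈ Finset.Icc 1 n, X i s ω = n * μ i + ∑ s ∈ Finset.Icc 1 n, ε i s ω := by
  rw [Finset.sum_congr rfl fun s hs => hX i s ω (Finset.mem_Icc.1 hs).1, Finset.sum_add_distrib]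
  simp

/-- The means cancel because the contrast compares `h` observations with `h / m` times `m`. -/
theorem NullModel.localStat_eq (hX : NullModel X μ ε) {m k h : ℕ} (hm : m ≠ 0) (hh : h ≤ m + k)
    (i : ι) (ω : Ω) :
    localStat X σhat m k h i ω = 1 / σhat i ω * |contrast ((h : ℝ) / m)
      fun j => ∑ s ∈ Finset.Icc 1 (sampleIndices m k h j), ε i s ω| := by
  have hm' : (m : ℝ) ≠ 0 := Nat.cast_ne_zero.2 hm
  rw [localStat, sum_Icc_succ_eq_sub _ (Nat.sub_le _ _)]
  simp only [hX.sum_Icc_one, contrast, sampleIndices, Matrix.cons_val_zero, Matrix.cons_val_one,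
    Matrix.cons_val, Nat.cast_sub hh]
  congr 2
  field_simp
  ring

theorem scaledSum_natCast_div (ε : ι → ℕ → Ω → ℝ) {h : ℕ} (hh : h ≠ 0) (n : ℕ) (i : ι) (ω : Ω) :
    scaledSum ε h i ((n : ℝ≥0) / h) ω = 1 / √(h : ℝ) * ∑ s ∈ Finset.Icc 1 n, ε i s ω := by
  have hn : (h : ℝ) * (((n : ℝ≥0) / h : ℝ≥0) : ℝ) = n := by
    rw [NNReal.coe_div, NNReal.coe_natCast, NNReal.coe_natCast,
      mul_div_cancel₀ _ (Nat.cast_ne_zero.2 hh)]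
  rw [scaledSum, partialSum, hn, Nat.floor_natCast]

/-- The local statistics as a function of the partial sums `q.1.1` at the three times, the ratio
`q.1.2` of the window length to the historical sample size, and the estimators `q.2`. -/
def studentizedContrast (q : ((ι × Fin 3 → ℝ) × ℝ) × (ι → ℝ)) (i : ι) : ℝ :=
  1 / q.2 i * |contrast q.1.2 fun j => q.1.1 (i, j)|

theorem measurable_studentizedContrast :
    Measurable (studentizedContrast : ((ι × Fin 3 → ℝ) × ℝ) × (ι → ℝ) → ι → ℝ) := by
  unfold studentizedContrast contrast
  exact measurable_pi_lambda _ fun i => (measurable_const.div (by fun_prop)).mul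
    (Measurable.abs (by fun_prop))

theorem continuousAt_studentizedContrast {q : ((ι × Fin 3 → ℝ) × ℝ) × (ι → ℝ)}
    (hq : ∀ i, q.2 i ≠ 0) : ContinuousAt studentizedContrast q := by
  refine continuousAt_pi.2 fun i => ?_
  have hs : ContinuousAt (fun q : ((ι × Fin 3 → ℝ) × ℝ) × (ι → ℝ) => q.2 i) q := by fun_prop
  have hv : ContinuousAt (fun q : ((ι × Fin 3 → ℝ) × ℝ) × (ι → ℝ) =>
      |contrast q.1.2 fun j => q.1.1 (i, j)|) q := by
    unfold contrast
    fun_prop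
  exact (continuousAt_const.div hs (hq i)).mul hv

theorem NullModel.scaledLocalStat_eq (hX : NullModel X μ ε) {m k h : ℕ} (hm : m ≠ 0) (hh0 : h ≠ 0)
    (hh : h ≤ m + k) (ω : Ω) :
    scaledLocalStat X σhat m k h ω = studentizedContrast
      (((fun p : ι × Fin 3 => scaledSum ε h p.1 (sampleIndices m k h p.2 / h) ω), (h : ℝ) / m),
        fun i => σhat i ω) := by
  funext i
  simp only [scaledLocalStat, studentizedContrast, hX.localStat_eq hm hh,
    scaledSum_natCast_div ε hh0, contrast_const_mul, abs_mul]
  rw [abs_of_nonneg (by positivity : 0 ≤ 1 / √(h : ℝ)), mul_left_comm]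

theorem studentizedContrast_const_mul {σ : ι → ℝ} (hσ : ∀ i, 0 < σ i) (v : ι × Fin 3 → ℝ) (b : ℝ) :
    studentizedContrast ((fun p => σ p.1 * v p, b), σ) =
      fun i => |contrast b fun j => v (i, j)| := by
  funext i
  simp only [studentizedContrast, contrast_const_mul, abs_mul, abs_of_pos (hσ i)]
  field_simp [(hσ i).ne']

variable [MeasurableSpace Ω] {P : Measure Ω}

theorem aemeasurable_scaledSum (hε : ∀ i s, AEMeasurable (ε i s) P) (m : ℕ) (i : ι) (u : ℝ≥0) :
    AEMeasurable (scaledSum ε m i u) P :=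
  (Finset.aemeasurable_fun_sum _ fun s _ => hε i s).const_mul _

theorem NullModel.aemeasurable_scaledLocalStat [Countable ι] (hX : NullModel X μ ε)
    (hε : ∀ i s, AEMeasurable (ε i s) P) (hσhat : ∀ i, AEMeasurable (σhat i) P) (m k h : ℕ) :
    AEMeasurable (scaledLocalStat X σhat m k h) P := by
  have hXs : ∀ i s, 1 ≤ s → AEMeasurable (X i s) P := fun i s hs => by
    rw [funext fun ω => hX i s ω hs]
    exact (hε i s).const_add _
  have hsum : ∀ i a b, 1 ≤ a → AEMeasurable (fun ω => ∑ s ∈ Finset.Icc a b, X i s ω) P :=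
    fun i a b ha => Finset.aemeasurable_fun_sum _ fun s hs =>
      hXs i s (ha.trans (Finset.mem_Icc.1 hs).1)
  refine aemeasurable_pi_lambda _ fun i => AEMeasurable.const_mul ?_ _
  exact (aemeasurable_const.div (hσhat i)).mul
    ((hsum i _ _ (Nat.le_add_left 1 _)).sub ((hsum i 1 m le_rfl).const_mul _)).abs

end Local

section Regime

variable {h : ℕ → ℕ} {β t : ℝ}

theorem tendsto_atTop_of_tendsto_div (hβ : 0 < β)
    (hratio : Tendsto (fun m : ℕ => (h m : ℝ) / m) atTop (𝓝 β)) : Tendsto h atTop atTop := by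
  refine tendsto_natCast_atTop_iff.1
    ((hratio.pos_mul_atTop hβ tendsto_natCast_atTop_atTop).congr' ?_)
  filter_upwards [eventually_ne_atTop 0] with m hm
  exact div_mul_cancel₀ _ (Nat.cast_ne_zero.2 hm)

theorem tendsto_floor_mul_div (hh : Tendsto h atTop atTop) (ht : 0 ≤ t) :
    Tendsto (fun m => (⌊h m * t⌋₊ : ℝ) / h m) atTop (𝓝 t) :=
  ((tendsto_nat_floor_mul_div_atTop ht).comp (tendsto_natCast_atTop_atTop.comp hh)).congr
    fun m => by simp only [Function.comp_apply, mul_comm t]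

theorem tendsto_add_floor_div (hβ : 0 < β)
    (hratio : Tendsto (fun m : ℕ => (h m : ℝ) / m) atTop (𝓝 β)) (ht : 0 ≤ t) :
    Tendsto (fun m => ((m + ⌊h m * t⌋₊ : ℕ) : ℝ) / h m) atTop (𝓝 (1 / β + t)) := by
  simp only [Nat.cast_add, add_div, one_div]
  exact ((hratio.inv₀ hβ.ne').congr fun m => inv_div _ _).add
    (tendsto_floor_mul_div (tendsto_atTop_of_tendsto_div hβ hratio) ht)

theorem eventually_window_le (hβ : 0 < β)
    (hratio : Tendsto (fun m : ℕ => (h m : ℝ) / m) atTop (𝓝 β)) (ht : 0 ≤ t)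
    (hβt : 1 < 1 / β + t) : ∀ᶠ m in atTop, h m ≤ m + ⌊h m * t⌋₊ := by
  filter_upwards [(tendsto_add_floor_div hβ hratio ht).eventually_const_lt hβt,
    (tendsto_atTop_of_tendsto_div hβ hratio).eventually_gt_atTop 0] with m hm hhm
  exact_mod_cast ((one_lt_div (Nat.cast_pos.2 hhm)).1 hm).le

theorem tendsto_sampleIndices_div (hβ : 0 < β)
    (hratio : Tendsto (fun m : ℕ => (h m : ℝ) / m) atTop (𝓝 β)) (ht : 0 ≤ t)
    (hβt : 1 < 1 / β + t) :
    Tendsto (fun m j => (sampleIndices m ⌊h m * t⌋₊ (h m) j : ℝ≥0) / h m) atTop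
      (𝓝 (contrastTimes β t)) := by
  have hend := tendsto_add_floor_div hβ hratio ht
  have hβ' : 0 < 1 / β := one_div_pos.2 hβ
  have hlast : Tendsto (fun m => ((m + ⌊h m * t⌋₊ : ℕ) : ℝ≥0) / h m) atTop
      (𝓝 (1 / β + t).toNNReal) := by
    rw [← NNReal.tendsto_coe, Real.coe_toNNReal _ (by linarith)]
    simpa using hend
  have hstart : Tendsto (fun m => ((m + ⌊h m * t⌋₊ - h m : ℕ) : ℝ≥0) / h m) atTop
      (𝓝 (1 / β + t - 1).toNNReal) := by
    rw [← NNReal.tendsto_coe, Real.coe_toNNReal _ (by linarith)]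
    refine (hend.sub_const 1).congr' ?_
    filter_upwards [eventually_window_le hβ hratio ht hβt,
      (tendsto_atTop_of_tendsto_div hβ hratio).eventually_ne_atTop 0] with m hm hhm
    rw [NNReal.coe_div, NNReal.coe_natCast, NNReal.coe_natCast, Nat.cast_sub hm, sub_div,
      div_self (Nat.cast_ne_zero.2 hhm)]
  have hhist : Tendsto (fun m : ℕ => (m : ℝ≥0) / h m) atTop (𝓝 (1 / β).toNNReal) := by
    rw [← NNReal.tendsto_coe, Real.coe_toNNReal _ hβ'.le]
    simpa using hratio.inv₀ hβ.ne'
  refine tendsto_pi_nhds.2 fun j => ?_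
  fin_cases j
  exacts [hlast, hstart, hhist]

end Regime

section Aggregation

variable {ι : Type*} [Fintype ι]

/-- The Euclidean norm of the statistics `q.1`, multiplied by the weight `q.2`. -/
def aggregate (q : (ι → ℝ) × ℝ) : ℝ := q.2 * √(∑ i, q.1 i ^ 2)

open scoped Classical in
/-- The Euclidean norm of those statistics `q.1 i` whose weighted value exceeds `c`, multiplied by
the weight `q.2`. -/
def aggregateAbove (c : ℝ) (q : (ι → ℝ) × ℝ) : ℝ :=
  q.2 * √(∑ i, q.1 i ^ 2 * (if q.2 * q.1 i > c then 1 else 0))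

theorem continuous_aggregate : Continuous (aggregate : (ι → ℝ) × ℝ → ℝ) := by
  unfold aggregate
  fun_prop

theorem measurable_aggregateAbove (c : ℝ) :
    Measurable (aggregateAbove c : (ι → ℝ) × ℝ → ℝ) := by
  unfold aggregateAbove
  refine measurable_snd.mul (Finset.measurable_fun_sum _ fun i _ => ?_).sqrt
  refine Measurable.mul (by fun_prop) (Measurable.ite ?_ measurable_const measurable_const)
  exact measurableSet_lt measurable_const (by fun_prop)

theorem abs_aggregateAbove_le (c : ℝ) (q : (ι → ℝ) × ℝ) :
    |aggregateAbove c q| ≤ |aggregate q| := by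
  unfold aggregateAbove aggregate
  rw [abs_mul, abs_mul, abs_of_nonneg (Real.sqrt_nonneg _), abs_of_nonneg (Real.sqrt_nonneg _)]
  gcongr with i
  refine mul_le_of_le_one_right (sq_nonneg _) ?_
  split_ifs <;> norm_num

theorem continuousAt_aggregateAbove_of_ne {c : ℝ} {q : (ι → ℝ) × ℝ} (hq : ∀ i, q.2 * q.1 i ≠ c) :
    ContinuousAt (aggregateAbove c) q := by
  classical
  have hind : ∀ i, ContinuousAt (fun p : (ι → ℝ) × ℝ =>
      if p.2 * p.1 i > c then (1 : ℝ) else 0) q := fun i => by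
    have hmul : ContinuousAt (fun p : (ι → ℝ) × ℝ => p.2 * p.1 i) q := by fun_prop
    rcases lt_or_gt_of_ne (hq i) with hlt | hgt
    · refine (continuousAt_const (y := (0 : ℝ))).congr ?_
      filter_upwards [hmul.eventually_lt_const hlt] with p hp
      rw [if_neg (not_lt.2 hp.le)]
    · refine (continuousAt_const (y := (1 : ℝ))).congr ?_
      filter_upwards [hmul.eventually_const_lt hgt] with p hp
      rw [if_pos hp]
  have hsum : ContinuousAt (fun p : (ι → ℝ) × ℝ =>
      ∑ i, p.1 i ^ 2 * (if p.2 * p.1 i > c then (1 : ℝ) else 0)) q :=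
    tendsto_finsetSum _ fun i _ => ContinuousAt.mul (by fun_prop) (hind i)
  have hprod : ContinuousAt (fun p : (ι → ℝ) × ℝ =>
      p.2 * √(∑ i, p.1 i ^ 2 * (if p.2 * p.1 i > c then (1 : ℝ) else 0))) q :=
    continuousAt_snd.mul hsum.sqrt
  unfold aggregateAbove
  convert hprod

theorem continuousAt_aggregateAbove_of_snd_eq_zero (c : ℝ) {q : (ι → ℝ) × ℝ} (hq : q.2 = 0) :
    ContinuousAt (aggregateAbove c) q := by
  have hzero : aggregateAbove c q = 0 := by rw [aggregateAbove, hq, zero_mul]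
  have hlim : Tendsto (fun p => |aggregate p|) (𝓝 q) (𝓝 0) := by
    simpa [aggregate, hq] using (continuous_aggregate.tendsto q).abs
  rw [ContinuousAt, hzero]
  exact squeeze_zero_norm (abs_aggregateAbove_le c) hlim

theorem ae_continuousAt_aggregateAbove_limitZ {Ω : Type*} [MeasurableSpace Ω] {P : Measure Ω}
    {W : ι → ℝ≥0 → Ω → ℝ} (hW : ∀ i, IsPreBrownianReal (W i) P) {β t : ℝ} (hβ : 0 < β)
    (ht : 0 ≤ t) (hβt : 1 < 1 / β + t) (c r : ℝ) :
    ∀ᵐ ω ∂P, ContinuousAt (aggregateAbove c) (fun i => limitZ W β t i ω, r) := by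
  rcases eq_or_ne r 0 with rfl | hr
  · exact ae_of_all _ fun ω => continuousAt_aggregateAbove_of_snd_eq_zero c rfl
  · filter_upwards [ae_all_iff.2 fun i => ae_limitZ_ne (hW i) hβ ht hβt (c / r)] with ω hω
    exact continuousAt_aggregateAbove_of_ne fun i hi => hω i (eq_div_of_mul_eq hr
      ((mul_comm _ _).trans hi))

variable {Ω : Type*}

theorem weight_mul_centralizedStat (ρ : ℝ → ℝ) (X : ι → ℕ → Ω → ℝ) (σhat : ι → Ω → ℝ)
    (m k h : ℕ) (ω : Ω) :
    weight ρ k h * centralizedStat X σhat m k h ω =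
      aggregate (scaledLocalStat X σhat m k h ω, ρ ((k : ℝ) / h)) := by
  simp only [weight, centralizedStat, aggregate, scaledLocalStat, mul_pow]
  rw [← Finset.mul_sum, Real.sqrt_mul (by positivity), Real.sqrt_sq (by positivity)]
  ring

theorem weight_mul_distributedStat (ρ : ℝ → ℝ) (c : ℝ) (X : ι → ℕ → Ω → ℝ) (σhat : ι → Ω → ℝ)
    (m k h : ℕ) (ω : Ω) :
    weight ρ k h * distributedStat ρ c X σhat m k h ω =
      aggregateAbove c (scaledLocalStat X σhat m k h ω, ρ ((k : ℝ) / h)) := by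
  have hw : ∀ i, ρ ((k : ℝ) / h) * (1 / √(h : ℝ) * localStat X σhat m k h i ω) =
      weight ρ k h * localStat X σhat m k h i ω := fun i => by rw [weight]; ring
  simp only [distributedStat, aggregateAbove, scaledLocalStat, mul_pow, mul_assoc, hw]
  rw [← Finset.mul_sum, Real.sqrt_mul (by positivity), Real.sqrt_sq (by positivity), weight]
  ring

end Aggregation

section Limit

variable {ι Ω Ω' : Type*} [MeasurableSpace Ω] [MeasurableSpace Ω'] {P : Measure Ω}
  [IsProbabilityMeasure P] {P' : Measure Ω'} [IsProbabilityMeasure P'] {ε : ι → ℕ → Ω → ℝ}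
  {σ : ι → ℝ} {W : ι → ℝ≥0 → Ω' → ℝ}

theorem FCLT.tendstoInDistribution_scaledSum {κ : Type*} [Finite κ] (hFCLT : FCLT ε σ W P P')
    (hε : ∀ i s, AEMeasurable (ε i s) P) (hW : ∀ i u, AEMeasurable (W i u) P')
    (hW_cont : ∀ᵐ ω ∂P', ∀ i, Continuous fun u => W i u ω) {n : ℕ → ℕ}
    (hn : Tendsto n atTop atTop) (a : κ → ι) {τ : ℕ → κ → ℝ≥0} {T : κ → ℝ≥0}
    (hτ : Tendsto τ atTop (𝓝 T)) :
    TendstoInDistribution (fun m ω p => scaledSum ε (n m) (a p) (τ m p) ω) atTop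
      (fun ω p => σ (a p) * W (a p) (T p) ω) (fun _ => P) P' :=
  (TendstoInDistributionD.comp_tendsto hFCLT hn).tendstoInDistribution_eval
    (fun m => aemeasurable_scaledSum hε (n m))
    (fun m => ae_of_all _ fun ω i => isCadlag_scaledSum ε (n m) i ω)
    (fun i u => (hW i u).const_mul (σ i))
    (hW_cont.mono fun _ hω i => (hω i).const_mul (σ i)) a hτ

theorem tendstoInDistribution_scaledLocalStat [Finite ι] {X : ι → ℕ → Ω → ℝ} {μ : ι → ℝ}
    {σhat : ℕ → ι → Ω → ℝ} {h : ℕ → ℕ} {β t : ℝ} (hX : NullModel X μ ε)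
    (hε : ∀ i s, AEMeasurable (ε i s) P) (hσhat_meas : ∀ m i, AEMeasurable (σhat m i) P)
    (hβ : 0 < β) (hratio : Tendsto (fun m : ℕ => (h m : ℝ) / m) atTop (𝓝 β)) (ht : 0 ≤ t)
    (hβt : 1 < 1 / β + t) (hW : ∀ i u, AEMeasurable (W i u) P')
    (hW_cont : ∀ᵐ ω ∂P', ∀ i, Continuous fun u => W i u ω) (hσ : ∀ i, 0 < σ i)
    (hFCLT : FCLT ε σ W P P')
    (hσhat : ∀ i, TendstoInMeasure P (fun m => σhat m i) atTop fun _ => σ i) :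
    TendstoInDistribution (fun m => scaledLocalStat X (σhat m) m ⌊h m * t⌋₊ (h m)) atTop
      (fun ω i => limitZ W β t i ω) (fun _ => P) P' := by
  have := Fintype.ofFinite ι
  have hh := tendsto_atTop_of_tendsto_div hβ hratio
  have hsums := hFCLT.tendstoInDistribution_scaledSum (κ := ι × Fin 3) hε hW hW_cont hh Prod.fst
    (tendsto_pi_nhds.2 fun p =>
      tendsto_pi_nhds.1 (tendsto_sampleIndices_div hβ hratio ht hβt) p.2)
  have hsums_ratio := hsums.prodMk_of_tendstoInMeasure_const _ _ _
    (tendstoInMeasure_const_of_tendsto hratio) fun m => aemeasurable_const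
  have hall := hsums_ratio.prodMk_of_tendstoInMeasure_const _ (fun m ω i => σhat m i ω) _ (c := σ)
    (tendstoInMeasure_pi hσhat) fun m => aemeasurable_pi_lambda _ (hσhat_meas m)
  have hlim := tendstoInDistribution_comp_of_ae_continuousAt measurable_studentizedContrast hall
    (ae_of_all _ fun ω => continuousAt_studentizedContrast fun i => (hσ i).ne')
  simp only [studentizedContrast_const_mul hσ] at hlim
  refine tendstoInDistribution_congr_of_eventually hlim
    (fun m => hX.aemeasurable_scaledLocalStat hε (hσhat_meas m) _ _ _) ?_
  filter_upwards [eventually_ne_atTop 0, hh.eventually_ne_atTop 0,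
    eventually_window_le hβ hratio ht hβt] with m hm hhm hle
  exact funext fun ω => (hX.scaledLocalStat_eq hm hhm hle ω).symm

end Limit

end Mosum

end

theorem mainTheorem1_general {ι Ω Ω' : Type*} [Fintype ι] [MeasurableSpace Ω] [MeasurableSpace Ω']
    {P : Measure Ω} [IsProbabilityMeasure P] {P' : Measure Ω'} [IsProbabilityMeasure P']
    {X ε : ι → ℕ → Ω → ℝ} {μ σ : ι → ℝ} {σhat : ℕ → ι → Ω → ℝ} {W : ι → ℝ≥0 → Ω' → ℝ}
    {h : ℕ → ℕ} {β : ℝ} {ρ : ℝ → ℝ} {t : ℝ} (c : ℝ)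
    (hε : ∀ i s, AEMeasurable (ε i s) P) (hσhat_meas : ∀ m i, AEMeasurable (σhat m i) P)
    (hX : Mosum.NullModel X μ ε) (hβ : 0 < β)
    (hratio : Tendsto (fun m : ℕ => (h m : ℝ) / m) atTop (𝓝 β))
    (hW : ∀ i, IsBrownianReal (W i) P') (hσ : ∀ i, 0 < σ i) (hFCLT : Mosum.FCLT ε σ W P P')
    (hσhat : ∀ i, TendstoInMeasure P (fun m => σhat m i) atTop fun _ => σ i)
    (ht : 0 ≤ t) (hβt : 1 < 1 / β + t) (hρ : ContinuousAt ρ t) :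
    TendstoInDistribution
      (fun (m : ℕ) ω => Mosum.weight ρ ⌊h m * t⌋₊ (h m) *
        Mosum.centralizedStat X (σhat m) m ⌊h m * t⌋₊ (h m) ω)
      atTop (Mosum.centralizedLimit ρ W β t) (fun _ => P) P' ∧
    TendstoInDistribution
      (fun (m : ℕ) ω => Mosum.weight ρ ⌊h m * t⌋₊ (h m) *
        Mosum.distributedStat ρ c X (σhat m) m ⌊h m * t⌋₊ (h m) ω)
      atTop (Mosum.distributedLimit ρ c W β t) (fun _ => P) P' := by
  have hlocal := Mosum.tendstoInDistribution_scaledLocalStat hX hε hσhat_meas hβ hratio ht hβt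
    (fun i => (hW i).aemeasurable) (ae_all_iff.2 fun i => (hW i).cont) hσ hFCLT hσhat
  have hweight : Tendsto (fun m => ρ ((⌊h m * t⌋₊ : ℝ) / h m)) atTop (𝓝 (ρ t)) :=
    hρ.tendsto.comp <|
      Mosum.tendsto_floor_mul_div (Mosum.tendsto_atTop_of_tendsto_div hβ hratio) ht
  have hpair := hlocal.prodMk_of_tendstoInMeasure_const _ _ _
    (Mosum.tendstoInMeasure_const_of_tendsto hweight) fun m => aemeasurable_const
  simp_rw [Mosum.weight_mul_centralizedStat, Mosum.weight_mul_distributedStat]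
  exact ⟨hpair.continuous_comp Mosum.continuous_aggregate,
    Mosum.tendstoInDistribution_comp_of_ae_continuousAt (Mosum.measurable_aggregateAbove c) hpair <|
      Mosum.ae_continuousAt_aggregateAbove_limitZ (fun i => (hW i).toIsPreBrownianReal) hβ ht hβt
        c (ρ t)⟩

theorem mainTheorem1 {Ω Ω' : Type*} [MeasurableSpace Ω] [MeasurableSpace Ω']
    (P : Measure Ω) [IsProbabilityMeasure P] (P' : Measure Ω') [IsProbabilityMeasure P']
    (d : ℕ) (X ε : Fin d → ℕ → Ω → ℝ) (μ σ : Fin d → ℝ) (σhat : ℕ → Fin d → Ω → ℝ)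
    (W : Fin d → ℝ≥0 → Ω' → ℝ) (h : ℕ → ℕ) (β : ℝ) (ρ : ℝ → ℝ) (c t : ℝ)
    (hε : ∀ i s, Measurable (ε i s))
    (hσhat_meas : ∀ m i, Measurable (σhat m i))
    (hX : Mosum.NullModel X μ ε)
    (hregime : Mosum.AsymptoticRegime h β)
    (hW : ∀ i, IsBrownianReal (W i) P')
    (hW_indep : iIndepFun (fun i ω u => W i u ω) P')
    (hσ : ∀ i, 0 < σ i)
    (hFCLT : Mosum.FCLT ε σ W P P')
    (hσhat : ∀ i, TendstoInMeasure P (fun m => σhat m i) atTop (fun _ => σ i))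
    (ht : 0 < t) (hρ : ContinuousAt ρ t) :
    TendstoInDistribution
      (fun (m : ℕ) ω => Mosum.weight ρ ⌊h m * t⌋₊ (h m) *
        Mosum.centralizedStat X (σhat m) m ⌊h m * t⌋₊ (h m) ω)
      atTop (Mosum.centralizedLimit ρ W β t) (fun _ => P) P' ∧
    TendstoInDistribution
      (fun (m : ℕ) ω => Mosum.weight ρ ⌊h m * t⌋₊ (h m) *
        Mosum.distributedStat ρ c X (σhat m) m ⌊h m * t⌋₊ (h m) ω)
      atTop (Mosum.distributedLimit ρ c W β t) (fun _ => P) P' := by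
  have hβt : 1 < 1 / β + t := lt_add_of_le_of_pos (one_le_one_div hregime.pos hregime.le_one) ht
  exact mainTheorem1_general c (fun i s => (hε i s).aemeasurable)
    (fun m i => (hσhat_meas m i).aemeasurable) hX hregime.pos hregime.ratio_tendsto hW hσ hFCLT
    hσhat ht.le hβt hρ
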